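/- For $0<p\le\infty$ let $\mathcal F_p$ be the Fock space of all entire functions $f$ with $\|f\|_p<\infty$, where $$\|f\|_p=\Big(\frac{p}{2\pi}\int_{\mathbb C}|f(z)|^p e^{-p|z|^2/2}\,dA(z)\Big)^{1/p}\ (0<p<\infty),\qquad \|f\|_\infty=\sup_{z\in\mathbb C}|f(z)|e^{-|z|^2/2},$$ and $dA$ is Lebesgue area measure on $\mathbb C$. Let $u$ be an entire function that is not identically zero, let $M_uf=uf$, and let $0<p,q\le\infty$. Then: 1. If $p\le q$, the following are equivalent: (a) $M_u(\mathcal F_p)\subseteq\mathcal F_q$; (b) $u$ is constant; (c) $M_u:\mathcal F_p\to\mathcal F_q$ is bounded, i.e. $M_u$ maps $\mathcal F_p$ into $\mathcal F_q$ and there is $C\ge0$ with $\|M_uf\|_q\le C\|f\|_p$ for all $f\in\mathcal F_p$; (d) $M_u:\mathcal F_p\to\mathcal F_q$ is globally Lipschitz continuous, i.e. $M_u$ maps $\mathcal F_p$ into $\mathcal F_q$ and there is $L\ge0$ with $\|M_uf-M_ug\|_q\le L\|f-g\|_p$ for all $f,g\in\mathcal F_p$. 2. If $p>q$, then $M_u$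 does not map $\mathcal F_p$ into $\mathcal F_q$. 3. For no $p,q$ is $M_u:\mathcal F_p\to\mathcal F_q$ compact; that is, it is never the case that $M_u$ maps $\mathcal F_p$ into $\mathcal F_q$ and for every sequence $(f_n)$ in $\mathcal F_p$ with $\sup_n\|f_n\|_p<\infty$ the sequence $(M_uf_n)$ has a subsequence converging to an element of $\mathcal F_q$ with respect to $\|\cdot\|_q$. -/

import Mathlib

open scoped ENNReal NNReal

/-- The Fock (quasi-)norm `‖f‖_p`, `0 < p ≤ ∞`, as an extended nonnegative number:
`((p/2π) ∫_ℂ |f(z)|^p e^{-p|z|²/2} dA(z))^{1/p}` for finite `p`, and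
`sup_z |f(z)| e^{-|z|²/2}` for `p = ∞`. -/
noncomputable def fockNorm (p : ℝ≥0∞) (f : ℂ → ℂ) : ℝ≥0∞ :=
  if p = ∞ then
    ⨆ z : ℂ, ENNReal.ofReal (‖f z‖ * Real.exp (-(‖z‖ ^ 2 / 2)))
  else
    (ENNReal.ofReal (p.toReal / (2 * Real.pi)) *
      ∫⁻ z : ℂ, ENNReal.ofReal
        (‖f z‖ ^ p.toReal * Real.exp (-(p.toReal * ‖z‖ ^ 2 / 2)))) ^ (1 / p.toReal)

/-- The Fock space `𝓕_p`: the entire functions of finite Fock norm. -/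
def fockSpace (p : ℝ≥0∞) : Set (ℂ → ℂ) :=
  {f | Differentiable ℂ f ∧ fockNorm p f < ∞}

/-- The multiplication operator `M_u f = u f`. -/
def mulOp (u f : ℂ → ℂ) : ℂ → ℂ := fun z => u z * f z

/-- `M_u` maps `𝓕_p` into `𝓕_q`. -/
def MulOpMaps (p q : ℝ≥0∞) (u : ℂ → ℂ) : Prop :=
  Set.MapsTo (mulOp u) (fockSpace p) (fockSpace q)

/-- `M_u : 𝓕_p → 𝓕_q` is (well defined and) a bounded linear operator. -/
def MulOpBounded (p q : ℝ≥0∞) (u : ℂ → ℂ) : Prop :=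
  MulOpMaps p q u ∧
    ∃ C : ℝ≥0, ∀ f ∈ fockSpace p, fockNorm q (mulOp u f) ≤ C * fockNorm p f

/-- `M_u : 𝓕_p → 𝓕_q` is (well defined and) globally Lipschitz continuous. -/
def MulOpLipschitz (p q : ℝ≥0∞) (u : ℂ → ℂ) : Prop :=
  MulOpMaps p q u ∧
    ∃ L : ℝ≥0, ∀ f ∈ fockSpace p, ∀ g ∈ fockSpace p,
      fockNorm q (mulOp u f - mulOp u g) ≤ L * fockNorm p (f - g)

/-- `M_u : 𝓕_p → 𝓕_q` is (well defined and) compact: the image of every bounded sequence of `𝓕_p`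
has a subsequence that converges in `𝓕_q`. -/
def MulOpCompact (p q : ℝ≥0∞) (u : ℂ → ℂ) : Prop :=
  MulOpMaps p q u ∧
    ∀ f : ℕ → ℂ → ℂ, (∀ n, f n ∈ fockSpace p) → (∃ R : ℝ≥0, ∀ n, fockNorm p (f n) ≤ R) →
      ∃ g ∈ fockSpace q, ∃ φ : ℕ → ℕ, StrictMono φ ∧
        Filter.Tendsto (fun n => fockNorm q (mulOp u (f (φ n)) - g)) Filter.atTop (nhds 0)

/-! The basic quantity is the weighted modulus |f(z)|e^{-|z|²/2}. A sub-mean value inequality for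
|h|^q, transported to any point by Weyl translations, bounds it by a constant times ‖f‖_p, uniformly
in z (`exists_ofReal_fockWeight_le_fockNorm`). This gives the bounded inclusions 𝓕_p ⊆ 𝓕_q for p ≤
q, hence everything positive about constant multipliers.

A multiplier is constant (`MulOpMaps.exists_eq_const`): by Liouville a nonconstant u satisfies
|u(wₙ)| ≥ 4ⁿ along a sparse sequence. The sum f of 2⁻ⁿ times the normalized kernel at wₙ lies in
every 𝓕_p, while its weighted modulus at wₙ is at least 2⁻ⁿ/2. So uf has weighted modulus at least
2ⁿ/2 at wₙ and lies in no 𝓕_q. The test function is explicit, so no closed graph argument is needed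
and the quasi-normed range is included.

It remains to treat nonzero constants. If q < p, the lattice sum of (1+|n|)^{-1/q} k_n lies in 𝓕_p
but not in 𝓕_q, the harmonic series being the obstruction. Compactness fails because the kernels k_n
are bounded and tend to 0 pointwise, yet have weighted modulus 1 at n. -/

open MeasureTheory Metric

/-! ### Sub-mean value inequalities for |h|^q -/

/-- The mean value inequality for the modulus of an entire function along a circle. -/
lemma enorm_apply_zero_le_lintegral_circle {h : ℂ → ℂ} (hh : Differentiable ℂ h) (z : ℂ) :
    ‖h 0‖ₑ ≤ ENNReal.ofReal (2 * Real.pi)⁻¹ *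
      ∫⁻ θ in Set.Ioc 0 (2 * Real.pi), ‖h (circleMap 0 1 θ * z)‖ₑ := by
  have hd : Differentiable ℂ fun ζ : ℂ => h (ζ * z) := hh.comp (by fun_prop)
  have hm := (hd.diffContOnCl (s := ball 0 |(1 : ℝ)|)).circleAverage
  rw [Real.circleAverage_def, zero_mul] at hm
  rw [← hm, enorm_smul, intervalIntegral.integral_of_le (by positivity),
    Real.enorm_of_nonneg (by positivity)]
  gcongr
  exact enorm_integral_le_lintegral_enorm _

lemma setLIntegral_ball_zero_rotation (F : ℂ → ℝ≥0∞) (ρ θ : ℝ) :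
    ∫⁻ z in ball 0 ρ, F (circleMap 0 1 θ * z) = ∫⁻ z in ball 0 ρ, F z := by
  have hmp : MeasurePreserving (rotation (Circle.exp θ)) volume volume :=
    (rotation (Circle.exp θ)).measurePreserving
  have := hmp.setLIntegral_comp_preimage_emb
    (rotation (Circle.exp θ)).toHomeomorph.measurableEmbedding F (ball 0 ρ)
  have hpre : rotation (Circle.exp θ) ⁻¹' ball 0 ρ = ball (0 : ℂ) ρ := by
    ext z
    simp only [Set.mem_preimage, mem_ball_zero_iff, LinearIsometryEquiv.norm_map]
  rw [hpre] at this
  rw [← this]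
  simp [circleMap]

lemma setLIntegral_ball_add_left (F : ℂ → ℝ≥0∞) (c : ℂ) (ρ : ℝ) :
    ∫⁻ z in ball 0 ρ, F (c + z) = ∫⁻ z in ball c ρ, F z := by
  have := (measurePreserving_add_left volume c).setLIntegral_comp_preimage_emb
    (measurableEmbedding_addLeft c) F (ball c ρ)
  rw [← this]
  congr 2
  ext z; simp

/-- The area mean value inequality for the modulus of an entire function. -/
lemma enorm_mul_volume_ball_le_setLIntegral {h : ℂ → ℂ} (hh : Differentiable ℂ h) (c : ℂ) (ρ : ℝ) :
    ‖h c‖ₑ * volume (ball c ρ) ≤ ∫⁻ z in ball c ρ, ‖h z‖ₑ := by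
  wlog hc : c = 0 generalizing h c
  · have := this (h := fun z => h (c + z)) (hh.comp (by fun_prop)) 0 rfl
    rw [setLIntegral_ball_add_left (fun z => ‖h z‖ₑ) c ρ] at this
    simpa using this
  subst hc
  have hcont : Continuous fun x : ℂ × ℝ => ‖h (circleMap 0 1 x.2 * x.1)‖ₑ :=
    (hh.continuous.comp (by fun_prop)).enorm
  calc ‖h 0‖ₑ * volume (ball (0 : ℂ) ρ) = ∫⁻ z in ball (0 : ℂ) ρ, ‖h 0‖ₑ := by simp
    -- Averaging the circle mean through z over all z in the ball, then using Fubini and rotation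
    -- invariance, avoids polar coordinates.
    _ ≤ ∫⁻ z in ball (0 : ℂ) ρ, ENNReal.ofReal (2 * Real.pi)⁻¹ *
          ∫⁻ θ in Set.Ioc 0 (2 * Real.pi), ‖h (circleMap 0 1 θ * z)‖ₑ :=
        lintegral_mono fun z => enorm_apply_zero_le_lintegral_circle hh z
    _ = ENNReal.ofReal (2 * Real.pi)⁻¹ * ∫⁻ θ in Set.Ioc 0 (2 * Real.pi),
          ∫⁻ z in ball (0 : ℂ) ρ, ‖h (circleMap 0 1 θ * z)‖ₑ := by
        rw [lintegral_const_mul' _ _ ENNReal.ofReal_ne_top,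
          lintegral_lintegral_swap hcont.measurable.aemeasurable]
    _ = ∫⁻ z in ball (0 : ℂ) ρ, ‖h z‖ₑ := by
        simp_rw [setLIntegral_ball_zero_rotation (fun z => ‖h z‖ₑ) ρ]
        rw [setLIntegral_const, Real.volume_Ioc, sub_zero, mul_comm (lintegral _ _), ← mul_assoc,
          ← ENNReal.ofReal_mul (by positivity), inv_mul_cancel₀ (by positivity),
          ENNReal.ofReal_one, one_mul]

/-- Maximize |h(z)|(1/2-|z|)^{2/q} over the disc, say at z₀, with A = |h(z₀)| and d = 1/2-|z₀|.
Maximality gives |h| ≤ 2^{2/q}A on the ball of radius d/2 about z₀, so there |h| is at most a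
constant times A^{1-q}|h|^q, and the area mean value inequality for |h| yields A^q d² ≲ ∫|h|^q.
Comparison with the origin gives |h(0)|^q ≤ 4A^q d²; the exponent 2/q is chosen to produce d², the
scale of the area. -/
lemma exists_rpow_norm_le_setLIntegral_of_le_one {q : ℝ} (hq : 0 < q) (hq1 : q ≤ 1) :
    ∃ C : ℝ≥0, ∀ h : ℂ → ℂ, Differentiable ℂ h →
      ENNReal.ofReal (‖h 0‖ ^ q) ≤ C * ∫⁻ z in ball 0 (1 / 2), ENNReal.ofReal (‖h z‖ ^ q) := by
  set K : ℝ := (2 ^ (2 / q)) ^ (1 - q) with hK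
  have hKpos : 0 < K := by positivity
  -- 16 = 4 · 4: one factor from (1/2)² at the origin, one from the area π(d/2)².
  refine ⟨(16 * K / Real.pi).toNNReal, fun h hh => ?_⟩
  by_cases h0 : h 0 = 0
  · simp [h0, Real.zero_rpow hq.ne']
  have hexp : 0 < 2 / q := by positivity
  obtain ⟨z₀, hz₀, hmax⟩ := (isCompact_closedBall (0 : ℂ) (1 / 2)).exists_isMaxOn
    ⟨0, by simp⟩ (f := fun z => ‖h z‖ * (1 / 2 - ‖z‖) ^ (2 / q))
    (Continuous.continuousOn (hh.continuous.norm.mul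
      ((continuous_const.sub continuous_norm).rpow_const fun _ => Or.inr hexp.le)))
  set d := 1 / 2 - ‖z₀‖ with hd
  set A := ‖h z₀‖ with hA
  have hd0 : 0 ≤ d := by simp at hz₀; simp [hd]; linarith
  have hmax' : ∀ z : ℂ, ‖z‖ ≤ 1 / 2 → ‖h z‖ * (1 / 2 - ‖z‖) ^ (2 / q) ≤ A * d ^ (2 / q) :=
    fun z hz => hmax (by simpa using hz)
  have hzero : ‖h 0‖ * (1 / 2) ^ (2 / q) ≤ A * d ^ (2 / q) := by
    simpa using hmax' 0 (by simp)
  have hpos : 0 < A * d ^ (2 / q) := lt_of_lt_of_le (by positivity) hzero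
  have hApos : 0 < A := by
    rcases (norm_nonneg (h z₀)).eq_or_lt with h' | h'
    · rw [hA, ← h', zero_mul] at hpos; exact absurd hpos (lt_irrefl _)
    · exact h'
  have hdpos : 0 < d := by
    rcases hd0.eq_or_lt with h' | h'
    · rw [← h', Real.zero_rpow hexp.ne', mul_zero] at hpos; exact absurd hpos (lt_irrefl _)
    · exact h'
  have hsq : ∀ x : ℝ, 0 ≤ x → (x ^ (2 / q)) ^ q = x ^ 2 := fun x hx => by
    rw [← Real.rpow_mul hx, div_mul_cancel₀ _ hq.ne']; norm_num
  have hnorm : ∀ z ∈ ball z₀ (d / 2), ‖z‖ ≤ 1 / 2 - d / 2 := fun z hz => by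
    have h1 : ‖z - z₀‖ < d / 2 := by simpa [dist_eq_norm] using hz
    have h2 : ‖z‖ ≤ ‖z - z₀‖ + ‖z₀‖ := by simpa using norm_add_le (z - z₀) z₀
    linarith
  have hloc : ∀ z ∈ ball z₀ (d / 2), ‖h z‖ ≤ 2 ^ (2 / q) * A := fun z hz => by
    have h1 := hnorm z hz
    have h2 : ‖h z‖ * (d / 2) ^ (2 / q) ≤ A * d ^ (2 / q) :=
      le_trans (by gcongr; linarith) (hmax' z (by linarith))
    rw [Real.div_rpow hd0 (by norm_num), mul_div_assoc', div_le_iff₀ (by positivity)] at h2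
    refine le_of_mul_le_mul_right (a := d ^ (2 / q)) ?_ (by positivity)
    linarith
  have hpt : ∀ z ∈ ball z₀ (d / 2), ‖h z‖ ≤ K * A ^ (1 - q) * ‖h z‖ ^ q := fun z hz => by
    rcases (norm_nonneg (h z)).eq_or_lt with h' | h'
    · rw [← h', Real.zero_rpow hq.ne', mul_zero]
    · calc ‖h z‖ = ‖h z‖ ^ (1 - q) * ‖h z‖ ^ q := by
            rw [← Real.rpow_add h']; simp
        _ ≤ (2 ^ (2 / q) * A) ^ (1 - q) * ‖h z‖ ^ q := by
            gcongr
            exact hloc z hz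
        _ = _ := by rw [Real.mul_rpow (by positivity) hApos.le]
  have hmain : ENNReal.ofReal (A * (Real.pi * (d / 2) ^ 2)) ≤ ENNReal.ofReal (K * A ^ (1 - q)) *
      ∫⁻ z in ball 0 (1 / 2), ENNReal.ofReal (‖h z‖ ^ q) := by
    calc ENNReal.ofReal (A * (Real.pi * (d / 2) ^ 2))
        = ‖h z₀‖ₑ * volume (ball z₀ (d / 2)) := by
          rw [Complex.volume_ball, ENNReal.ofReal_mul hApos.le, ENNReal.ofReal_mul Real.pi_pos.le,
            ENNReal.ofReal_pow (by positivity), hA, ofReal_norm, mul_comm (ENNReal.ofReal Real.pi)]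
          congr 2
          simp [ENNReal.ofReal, NNReal.pi, Real.toNNReal_of_nonneg Real.pi_pos.le]
          rfl
      _ ≤ ∫⁻ z in ball z₀ (d / 2), ‖h z‖ₑ := enorm_mul_volume_ball_le_setLIntegral hh _ _
      _ ≤ ∫⁻ z in ball z₀ (d / 2), ENNReal.ofReal (K * A ^ (1 - q)) *
            ENNReal.ofReal (‖h z‖ ^ q) := by
          refine setLIntegral_mono' measurableSet_ball fun z hz => ?_
          rw [← ENNReal.ofReal_mul (by positivity), ← ofReal_norm]
          exact ENNReal.ofReal_le_ofReal (hpt z hz)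
      _ = ENNReal.ofReal (K * A ^ (1 - q)) *
            ∫⁻ z in ball z₀ (d / 2), ENNReal.ofReal (‖h z‖ ^ q) :=
          lintegral_const_mul' _ _ ENNReal.ofReal_ne_top
      _ ≤ _ := by
          gcongr
          intro z hz
          have := hnorm z hz
          simp only [mem_ball, dist_zero_right]
          linarith
  have hend : ‖h 0‖ ^ q ≤ 16 / (Real.pi * A ^ (1 - q)) * (A * (Real.pi * (d / 2) ^ 2)) := by
    have h1 := Real.rpow_le_rpow (by positivity) hzero hq.le
    rw [Real.mul_rpow (by positivity) (by positivity), hsq _ (by norm_num),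
      Real.mul_rpow (by positivity) (by positivity), hsq _ hd0] at h1
    have h2 : A = A ^ (1 - q) * A ^ q := by rw [← Real.rpow_add hApos]; simp
    have h3 : 0 < A ^ (1 - q) := by positivity
    calc ‖h 0‖ ^ q ≤ 4 * (A ^ q * d ^ 2) := by linarith
      _ = 16 / (Real.pi * A ^ (1 - q)) * ((A ^ (1 - q) * A ^ q) * (Real.pi * (d / 2) ^ 2)) := by
          field_simp; ring
      _ = _ := by rw [← h2]
  calc ENNReal.ofReal (‖h 0‖ ^ q)
      ≤ ENNReal.ofReal (16 / (Real.pi * A ^ (1 - q))) *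
          ENNReal.ofReal (A * (Real.pi * (d / 2) ^ 2)) := by
        rw [← ENNReal.ofReal_mul (by positivity)]
        exact ENNReal.ofReal_le_ofReal hend
    _ ≤ ENNReal.ofReal (16 / (Real.pi * A ^ (1 - q))) * (ENNReal.ofReal (K * A ^ (1 - q)) *
          ∫⁻ z in ball 0 (1 / 2), ENNReal.ofReal (‖h z‖ ^ q)) := by gcongr
    _ = _ := by
        rw [← mul_assoc, ← ENNReal.ofReal_mul (by positivity)]
        congr 1
        change _ = ENNReal.ofReal _
        congr 1
        have h3 : 0 < A ^ (1 - q) := by positivity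
        field_simp

/-- A mean value inequality for `|h| ^ q`, `0 < q < ∞`, with `h` entire. -/
lemma exists_rpow_norm_le_setLIntegral {q : ℝ} (hq : 0 < q) :
    ∃ C : ℝ≥0, ∀ h : ℂ → ℂ, Differentiable ℂ h →
      ENNReal.ofReal (‖h 0‖ ^ q) ≤ C * ∫⁻ z in ball 0 (1 / 2), ENNReal.ofReal (‖h z‖ ^ q) := by
  have hk : 0 < (⌈q⌉₊ : ℝ) := by exact_mod_cast Nat.ceil_pos.2 hq
  -- Pass to the entire function h^⌈q⌉ with exponent q/⌈q⌉ ≤ 1.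
  obtain ⟨C, hC⟩ := exists_rpow_norm_le_setLIntegral_of_le_one (q := q / ⌈q⌉₊) (by positivity)
    ((div_le_one hk).2 (Nat.le_ceil q))
  refine ⟨C, fun h hh => ?_⟩
  have hpow : ∀ z, ‖h z ^ ⌈q⌉₊‖ ^ (q / ⌈q⌉₊) = ‖h z‖ ^ q := fun z => by
    rw [norm_pow, ← Real.rpow_natCast, ← Real.rpow_mul (norm_nonneg _), mul_div_cancel₀ _ hk.ne']
  simpa only [hpow] using hC (fun z => h z ^ ⌈q⌉₊) (hh.pow _)

/-! ### Pointwise estimates and inclusions between Fock spaces -/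

/-- The weighted modulus `|f(z)| e^{-|z|²/2}`. -/
noncomputable def fockWeight (f : ℂ → ℂ) (z : ℂ) : ℝ := ‖f z‖ * Real.exp (-(‖z‖ ^ 2 / 2))

lemma fockWeight_nonneg (f : ℂ → ℂ) (z : ℂ) : 0 ≤ fockWeight f z := by
  unfold fockWeight; positivity

/-- Weyl translation, from |w+z|² = |w|² + 2 Re(w̄z) + |z|². It moves w to the origin, so local
estimates there hold at every w with the same constant. -/
lemma fockWeight_add_eq (f : ℂ → ℂ) (w z : ℂ) :
    fockWeight f (w + z) = ‖f (w + z) * Complex.exp (-(starRingEnd ℂ w * z) - ‖w‖ ^ 2 / 2)‖ *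
      Real.exp (-(‖z‖ ^ 2 / 2)) := by
  rw [fockWeight, norm_mul, Complex.norm_exp, mul_assoc, ← Real.exp_add]
  congr 2
  have h1 : ((‖w‖ : ℂ) ^ 2 / 2).re = ‖w‖ ^ 2 / 2 := by norm_cast
  rw [Complex.sub_re, h1, ← Complex.normSq_eq_norm_sq, ← Complex.normSq_eq_norm_sq,
    ← Complex.normSq_eq_norm_sq]
  simp [Complex.normSq_apply]
  ring

/-- The local pointwise estimate in Fock spaces. -/
lemma exists_rpow_fockWeight_le_setLIntegral {q : ℝ} (hq : 0 < q) :
    ∃ C : ℝ≥0, ∀ f : ℂ → ℂ, Differentiable ℂ f → ∀ w : ℂ,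
      ENNReal.ofReal (fockWeight f w ^ q) ≤
        C * ∫⁻ z in ball w (1 / 2), ENNReal.ofReal (fockWeight f z ^ q) := by
  obtain ⟨C, hC⟩ := exists_rpow_norm_le_setLIntegral hq
  -- On the ball of radius 1/2 the Gaussian factor e^{-q|z|²/2} is at least e^{-q/2}.
  refine ⟨C * (Real.exp (q / 2)).toNNReal, fun f hf w => ?_⟩
  set h : ℂ → ℂ := fun z => f (w + z) * Complex.exp (-(starRingEnd ℂ w * z) - ‖w‖ ^ 2 / 2) with hh
  have hhd : Differentiable ℂ h := by
    have : Differentiable ℂ fun z => f (w + z) := hf.comp (by fun_prop)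
    exact this.mul (by fun_prop)
  have h0 : fockWeight f w = ‖h 0‖ := by
    have := fockWeight_add_eq f w 0
    simpa [hh] using this
  rw [h0, ← setLIntegral_ball_add_left (fun z => ENNReal.ofReal (fockWeight f z ^ q)),
    ENNReal.coe_mul, mul_assoc, ← lintegral_const_mul' _ _ ENNReal.coe_ne_top]
  refine (hC h hhd).trans ?_
  refine mul_le_mul' le_rfl (setLIntegral_mono' measurableSet_ball fun z hz => ?_)
  change _ ≤ ENNReal.ofReal _ * _
  rw [← ENNReal.ofReal_mul (by positivity), fockWeight_add_eq]
  refine ENNReal.ofReal_le_ofReal ?_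
  rw [Real.mul_rpow (norm_nonneg _) (Real.exp_pos _).le, ← Real.exp_mul, mul_left_comm,
    ← Real.exp_add]
  refine le_mul_of_one_le_right (by positivity) (Real.one_le_exp ?_)
  have : ‖z‖ < 1 / 2 := by simpa using hz
  have h2 : ‖z‖ ^ 2 ≤ 1 := by nlinarith [norm_nonneg z]
  nlinarith

lemma fockNorm_top (f : ℂ → ℂ) : fockNorm ∞ f = ⨆ z, ENNReal.ofReal (fockWeight f z) := by
  simp [fockNorm, fockWeight]

lemma fockNorm_of_ne_top {p : ℝ≥0∞} (hp : p ≠ ∞) (f : ℂ → ℂ) :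
    fockNorm p f = (ENNReal.ofReal (p.toReal / (2 * Real.pi)) *
      ∫⁻ z, ENNReal.ofReal (fockWeight f z ^ p.toReal)) ^ (1 / p.toReal) := by
  rw [fockNorm, if_neg hp]
  congr 3
  funext z
  rw [fockWeight, Real.mul_rpow (norm_nonneg _) (Real.exp_pos _).le, ← Real.exp_mul]
  congr 3
  ring

lemma lintegral_fockWeight_rpow {p : ℝ≥0∞} (hp0 : 0 < p) (hp : p ≠ ∞) (f : ℂ → ℂ) :
    ∫⁻ z, ENNReal.ofReal (fockWeight f z ^ p.toReal) =
      ENNReal.ofReal (2 * Real.pi / p.toReal) * fockNorm p f ^ p.toReal := by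
  have hpr : 0 < p.toReal := ENNReal.toReal_pos hp0.ne' hp
  rw [fockNorm_of_ne_top hp, ← ENNReal.rpow_mul, one_div_mul_cancel hpr.ne', ENNReal.rpow_one,
    ← mul_assoc, ← ENNReal.ofReal_mul (by positivity)]
  have : 2 * Real.pi / p.toReal * (p.toReal / (2 * Real.pi)) = 1 := by
    have := Real.pi_pos.ne'
    field_simp
  rw [this, ENNReal.ofReal_one, one_mul]

lemma fockNorm_lt_top_iff {p : ℝ≥0∞} (hp0 : 0 < p) (hp : p ≠ ∞) (f : ℂ → ℂ) :
    fockNorm p f < ∞ ↔ ∫⁻ z, ENNReal.ofReal (fockWeight f z ^ p.toReal) < ∞ := by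
  have hpr : 0 < p.toReal := ENNReal.toReal_pos hp0.ne' hp
  constructor
  · intro h
    rw [lintegral_fockWeight_rpow hp0 hp]
    exact ENNReal.mul_lt_top ENNReal.ofReal_lt_top (ENNReal.rpow_lt_top_of_nonneg hpr.le h.ne)
  · intro h
    rw [fockNorm_of_ne_top hp]
    exact ENNReal.rpow_lt_top_of_nonneg (by positivity)
      (ENNReal.mul_lt_top ENNReal.ofReal_lt_top h).ne

lemma ofReal_fockWeight_rpow (f : ℂ → ℂ) (z : ℂ) {r : ℝ} (hr : 0 ≤ r) :
    ENNReal.ofReal (fockWeight f z ^ r) = ENNReal.ofReal (fockWeight f z) ^ r :=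
  (ENNReal.ofReal_rpow_of_nonneg (fockWeight_nonneg f z) hr).symm

lemma measurable_fockWeight_rpow {f : ℂ → ℂ} (hf : Continuous f) (r : ℝ) :
    Measurable fun z => ENNReal.ofReal (fockWeight f z ^ r) := by
  have : Measurable (fockWeight f) := Continuous.measurable (by unfold fockWeight; fun_prop)
  exact (this.pow_const r).ennreal_ofReal

/-- Point evaluations, weighted by the Gaussian, are uniformly bounded on Fock spaces. -/
lemma exists_ofReal_fockWeight_le_fockNorm {p : ℝ≥0∞} (hp0 : 0 < p) :
    ∃ C : ℝ≥0, ∀ f : ℂ → ℂ, Differentiable ℂ f → ∀ w,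
      ENNReal.ofReal (fockWeight f w) ≤ C * fockNorm p f := by
  by_cases hp : p = ∞
  · subst hp
    refine ⟨1, fun f _ w => ?_⟩
    rw [fockNorm_top, ENNReal.coe_one, one_mul]
    exact le_iSup (fun z => ENNReal.ofReal (fockWeight f z)) w
  have hpr : 0 < p.toReal := ENNReal.toReal_pos hp0.ne' hp
  obtain ⟨C, hC⟩ := exists_rpow_fockWeight_le_setLIntegral hpr
  set D : ℝ≥0∞ := (C * ENNReal.ofReal (2 * Real.pi / p.toReal)) ^ (1 / p.toReal) with hD
  have hDtop : D ≠ ∞ := ENNReal.rpow_ne_top_of_nonneg (by positivity)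
    (ENNReal.mul_ne_top ENNReal.coe_ne_top ENNReal.ofReal_ne_top)
  refine ⟨D.toNNReal, fun f hf w => ?_⟩
  rw [ENNReal.coe_toNNReal hDtop]
  have h1 : ENNReal.ofReal (fockWeight f w) ^ p.toReal ≤ C *
      (ENNReal.ofReal (2 * Real.pi / p.toReal) * fockNorm p f ^ p.toReal) := by
    rw [← ofReal_fockWeight_rpow f w hpr.le, ← lintegral_fockWeight_rpow hp0 hp]
    exact (hC f hf w).trans (mul_le_mul' le_rfl (setLIntegral_le_lintegral _ _))
  rw [← ENNReal.rpow_le_rpow_iff hpr, ENNReal.mul_rpow_of_nonneg _ _ hpr.le, hD,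
    ← ENNReal.rpow_mul, one_div_mul_cancel hpr.ne', ENNReal.rpow_one, mul_assoc]
  exact h1

/-- The inclusion `𝓕_p ⊆ 𝓕_q` for `p ≤ q` is bounded. -/
lemma exists_fockNorm_le_fockNorm {p q : ℝ≥0∞} (hp0 : 0 < p) (hpq : p ≤ q) :
    ∃ C : ℝ≥0, ∀ f : ℂ → ℂ, Differentiable ℂ f → fockNorm q f ≤ C * fockNorm p f := by
  obtain ⟨C, hC⟩ := exists_ofReal_fockWeight_le_fockNorm hp0
  by_cases hq : q = ∞
  · subst hq
    refine ⟨C, fun f hf => ?_⟩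
    rw [fockNorm_top]
    exact iSup_le (hC f hf)
  have hp : p ≠ ∞ := ne_top_of_le_ne_top hq hpq
  have hpr : 0 < p.toReal := ENNReal.toReal_pos hp0.ne' hp
  have hqr : 0 < q.toReal := ENNReal.toReal_pos (hp0.trans_le hpq).ne' hq
  have hpqr : 0 ≤ q.toReal - p.toReal := sub_nonneg.2 (ENNReal.toReal_mono hq hpq)
  set D : ℝ≥0∞ := (ENNReal.ofReal (q.toReal / (2 * Real.pi)) * ((C : ℝ≥0∞) ^ (q.toReal - p.toReal) *
    ENNReal.ofReal (2 * Real.pi / p.toReal))) ^ (1 / q.toReal) with hD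
  have hDtop : D ≠ ∞ := ENNReal.rpow_ne_top_of_nonneg (by positivity)
    (ENNReal.mul_ne_top ENNReal.ofReal_ne_top (ENNReal.mul_ne_top
      (ENNReal.rpow_ne_top_of_nonneg hpqr ENNReal.coe_ne_top) ENNReal.ofReal_ne_top))
  refine ⟨D.toNNReal, fun f hf => ?_⟩
  rw [ENNReal.coe_toNNReal hDtop]
  -- Split the q-th power into powers q-p and p, and bound the first pointwise by (C‖f‖_p)^{q-p}.
  have hint : ∫⁻ z, ENNReal.ofReal (fockWeight f z ^ q.toReal) ≤
      (C : ℝ≥0∞) ^ (q.toReal - p.toReal) * ENNReal.ofReal (2 * Real.pi / p.toReal) *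
        fockNorm p f ^ q.toReal := by
    calc ∫⁻ z, ENNReal.ofReal (fockWeight f z ^ q.toReal)
        ≤ ∫⁻ z, (C * fockNorm p f) ^ (q.toReal - p.toReal) *
            ENNReal.ofReal (fockWeight f z ^ p.toReal) := by
          refine lintegral_mono fun z => ?_
          rw [ofReal_fockWeight_rpow f z hqr.le, ofReal_fockWeight_rpow f z hpr.le]
          calc ENNReal.ofReal (fockWeight f z) ^ q.toReal
              = ENNReal.ofReal (fockWeight f z) ^ (q.toReal - p.toReal) *
                  ENNReal.ofReal (fockWeight f z) ^ p.toReal := by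
                rw [← ENNReal.rpow_add_of_nonneg _ _ hpqr hpr.le, sub_add_cancel]
            _ ≤ _ := by gcongr; exact hC f hf z
      _ = (C * fockNorm p f) ^ (q.toReal - p.toReal) *
            ∫⁻ z, ENNReal.ofReal (fockWeight f z ^ p.toReal) :=
          lintegral_const_mul _ (measurable_fockWeight_rpow hf.continuous _)
      _ = _ := by
          rw [lintegral_fockWeight_rpow hp0 hp, ENNReal.mul_rpow_of_nonneg _ _ hpqr]
          rw [mul_mul_mul_comm, ← ENNReal.rpow_add_of_nonneg _ _ hpqr hpr.le, sub_add_cancel]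
  rw [fockNorm_of_ne_top hq]
  calc _ ≤ (ENNReal.ofReal (q.toReal / (2 * Real.pi)) *
        ((C : ℝ≥0∞) ^ (q.toReal - p.toReal) * ENNReal.ofReal (2 * Real.pi / p.toReal) *
        fockNorm p f ^ q.toReal)) ^ (1 / q.toReal) := by gcongr
    _ = _ := by
      rw [← mul_assoc, ENNReal.mul_rpow_of_nonneg _ _ (by positivity), ← ENNReal.rpow_mul,
        mul_one_div_cancel hqr.ne', ENNReal.rpow_one]

lemma fockSpace_mono {p q : ℝ≥0∞} (hp0 : 0 < p) (hpq : p ≤ q) : fockSpace p ⊆ fockSpace q := by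
  obtain ⟨C, hC⟩ := exists_fockNorm_le_fockNorm hp0 hpq
  exact fun f hf => ⟨hf.1, (hC f hf.1).trans_lt (ENNReal.mul_lt_top ENNReal.coe_lt_top hf.2)⟩

lemma fockWeight_mul (u f : ℂ → ℂ) (z : ℂ) :
    fockWeight (mulOp u f) z = ‖u z‖ * fockWeight f z := by
  rw [fockWeight, fockWeight, mulOp, norm_mul, mul_assoc]

lemma fockNorm_mulOp_const {p : ℝ≥0∞} (hp0 : 0 < p) (c : ℂ) (f : ℂ → ℂ) :
    fockNorm p (mulOp (fun _ => c) f) = ‖c‖ₑ * fockNorm p f := by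
  by_cases hp : p = ∞
  · subst hp
    simp_rw [fockNorm_top, fockWeight_mul, ENNReal.ofReal_mul (norm_nonneg c), ofReal_norm,
      ENNReal.mul_iSup]
  have hpr : 0 < p.toReal := ENNReal.toReal_pos hp0.ne' hp
  simp_rw [fockNorm_of_ne_top hp, fockWeight_mul,
    Real.mul_rpow (norm_nonneg c) (fockWeight_nonneg f _),
    ENNReal.ofReal_mul (Real.rpow_nonneg (norm_nonneg c) _)]
  rw [lintegral_const_mul' _ _ ENNReal.ofReal_ne_top, mul_left_comm,
    ENNReal.mul_rpow_of_nonneg _ _ (by positivity),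
    ← ENNReal.ofReal_rpow_of_nonneg (norm_nonneg c) hpr.le, ← ENNReal.rpow_mul,
    mul_one_div_cancel hpr.ne', ENNReal.rpow_one, ofReal_norm]

/-! ### Normalized kernels -/

/-- The normalized reproducing kernel of the Fock space at `w`. -/
noncomputable def fockKernel (w z : ℂ) : ℂ := Complex.exp (starRingEnd ℂ w * z - ‖w‖ ^ 2 / 2)

lemma differentiable_fockKernel (w : ℂ) : Differentiable ℂ (fockKernel w) := by
  unfold fockKernel; fun_prop

/-- Completing the square: each kernel is a Gaussian bump of height 1 centred at w, so its norm does
not depend on w. -/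
lemma fockWeight_fockKernel (w z : ℂ) :
    fockWeight (fockKernel w) z = Real.exp (-(‖z - w‖ ^ 2 / 2)) := by
  rw [fockWeight, fockKernel, Complex.norm_exp, ← Real.exp_add]
  congr 1
  have h1 : ((‖w‖ : ℂ) ^ 2 / 2).re = ‖w‖ ^ 2 / 2 := by norm_cast
  rw [Complex.sub_re, h1, ← Complex.normSq_eq_norm_sq, ← Complex.normSq_eq_norm_sq,
    ← Complex.normSq_eq_norm_sq]
  simp [Complex.normSq_apply]
  ring

lemma lintegral_gaussian_rpow_lt_top {r : ℝ} (hr : 0 < r) :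
    ∫⁻ z : ℂ, ENNReal.ofReal (Real.exp (-(‖z‖ ^ 2 / 2)) ^ r) < ∞ := by
  have h := GaussianFourier.integrable_cexp_neg_mul_sq_norm_add (V := ℂ) (b := (r / 2 : ℝ))
    (by simpa using hr) 0 0
  have h2 := h.hasFiniteIntegral
  refine lt_of_eq_of_lt (lintegral_congr fun z => ?_) h2
  rw [← ofReal_norm, Complex.norm_exp, ← Real.exp_mul]
  congr 2
  have : (-((r / 2 : ℝ) : ℂ) * (‖z‖ : ℂ) ^ 2 + 0 * (inner ℝ (0 : ℂ) z : ℝ)) =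
    ((-(r / 2) * ‖z‖ ^ 2 : ℝ) : ℂ) := by push_cast; ring
  rw [this, Complex.ofReal_re]
  ring

lemma lintegral_fockWeight_fockKernel_rpow (w : ℂ) (r : ℝ) :
    ∫⁻ z, ENNReal.ofReal (fockWeight (fockKernel w) z ^ r) =
      ∫⁻ z : ℂ, ENNReal.ofReal (Real.exp (-(‖z‖ ^ 2 / 2)) ^ r) := by
  simp_rw [fockWeight_fockKernel]
  exact lintegral_sub_right_eq_self
    (fun z : ℂ => ENNReal.ofReal (Real.exp (-(‖z‖ ^ 2 / 2)) ^ r)) w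

lemma exists_fockNorm_fockKernel_le {p : ℝ≥0∞} (hp0 : 0 < p) :
    ∃ R : ℝ≥0, ∀ w, fockNorm p (fockKernel w) ≤ R := by
  by_cases hp : p = ∞
  · subst hp
    refine ⟨1, fun w => ?_⟩
    rw [fockNorm_top]
    refine iSup_le fun z => ?_
    rw [fockWeight_fockKernel, ENNReal.coe_one, ENNReal.ofReal_le_one, Real.exp_le_one_iff]
    simp only [Left.neg_nonpos_iff]; positivity
  have hpr : 0 < p.toReal := ENNReal.toReal_pos hp0.ne' hp
  have heq : ∀ w, fockNorm p (fockKernel w) = fockNorm p (fockKernel 0) := fun w => by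
    simp_rw [fockNorm_of_ne_top hp, lintegral_fockWeight_fockKernel_rpow]
  have hfin : fockNorm p (fockKernel 0) < ∞ := by
    rw [fockNorm_lt_top_iff hp0 hp, lintegral_fockWeight_fockKernel_rpow]
    exact lintegral_gaussian_rpow_lt_top hpr
  exact ⟨(fockNorm p (fockKernel 0)).toNNReal, fun w => by
    rw [heq, ENNReal.coe_toNNReal hfin.ne]⟩

/-! ### Series of kernels with geometric coefficients -/

lemma differentiable_tsum_of_forall_summable_bound {ι : Type*} {F : ι → ℂ → ℂ}
    (hF : ∀ i, Differentiable ℂ (F i))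
    (hb : ∀ R : ℝ, ∃ v : ι → ℝ, Summable v ∧ ∀ i z, ‖z‖ < R → ‖F i z‖ ≤ v i) :
    Differentiable ℂ fun z => ∑' i, F i z := by
  intro z
  obtain ⟨v, hv, hle⟩ := hb (‖z‖ + 1)
  have := Complex.differentiableOn_tsum_of_summable_norm hv (fun i => (hF i).differentiableOn)
    (isOpen_ball (x := (0 : ℂ)) (ε := ‖z‖ + 1)) fun i w hw => hle i w (by simpa using hw)
  exact this.differentiableAt (isOpen_ball.mem_nhds (by simp))

lemma norm_eq_fockWeight_mul_exp (f : ℂ → ℂ) (z : ℂ) :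
    ‖f z‖ = fockWeight f z * Real.exp (‖z‖ ^ 2 / 2) := by
  rw [fockWeight, mul_assoc, ← Real.exp_add]; simp

lemma fockWeight_tsum_le {ι : Type*} {F : ι → ℂ → ℂ} {z : ℂ} (hs : Summable fun i => ‖F i z‖) :
    fockWeight (fun z => ∑' i, F i z) z ≤ ∑' i, fockWeight (F i) z := by
  simp only [fockWeight]
  rw [tsum_mul_right]
  gcongr
  exact norm_tsum_le_tsum_norm hs

/-- Subadditivity of t^r; it replaces the triangle inequality in the quasi-normed range. -/
lemma ENNReal.tsum_rpow_le {ι : Type*} (x : ι → ℝ≥0∞) {r : ℝ} (hr : 0 < r) (hr1 : r ≤ 1) :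
    (∑' i, x i) ^ r ≤ ∑' i, x i ^ r := by
  have ht : Filter.Tendsto (fun s : Finset ι => (∑ i ∈ s, x i) ^ r) Filter.atTop
      (nhds ((∑' i, x i) ^ r)) :=
    (ENNReal.continuous_rpow_const.tendsto _).comp ENNReal.summable.hasSum
  refine le_of_tendsto' ht fun s => ?_
  refine le_trans ?_ (ENNReal.sum_le_tsum s)
  exact Finset.le_sum_of_subadditive (fun y : ℝ≥0∞ => y ^ r) (by simp [hr])
    (fun a b => ENNReal.rpow_add_le_add_rpow a b hr.le hr1) s x

/-- The superposition `∑ 2⁻ⁿ k_{wₙ}` of normalized kernels. -/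
noncomputable def kernelSeries (w : ℕ → ℂ) (z : ℂ) : ℂ :=
  ∑' n, mulOp (fun _ => (1 / 2 : ℂ) ^ n) (fockKernel (w n)) z

lemma fockWeight_kernelSeries_term (w : ℂ) (n : ℕ) (z : ℂ) :
    fockWeight (mulOp (fun _ => (1 / 2 : ℂ) ^ n) (fockKernel w)) z =
      (1 / 2) ^ n * Real.exp (-(‖z - w‖ ^ 2 / 2)) := by
  rw [fockWeight_mul, fockWeight_fockKernel]; simp

lemma exp_neg_sq_half_le_one (x : ℝ) : Real.exp (-(x ^ 2 / 2)) ≤ 1 := by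
  rw [Real.exp_le_one_iff, neg_nonpos]; positivity

lemma fockWeight_kernelSeries_term_le (w : ℂ) (n : ℕ) (z : ℂ) :
    fockWeight (mulOp (fun _ => (1 / 2 : ℂ) ^ n) (fockKernel w)) z ≤ (1 / 2) ^ n := by
  rw [fockWeight_kernelSeries_term]
  exact mul_le_of_le_one_right (by positivity) (exp_neg_sq_half_le_one _)

lemma summable_kernelSeries_weight (w : ℕ → ℂ) (z : ℂ) :
    Summable fun n => (1 / 2 : ℝ) ^ n * Real.exp (-(‖z - w n‖ ^ 2 / 2)) :=
  summable_geometric_two.of_nonneg_of_le (fun n => by positivity) fun n =>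
    mul_le_of_le_one_right (by positivity) (exp_neg_sq_half_le_one _)

lemma summable_norm_kernelSeries_term (w : ℕ → ℂ) (z : ℂ) :
    Summable fun n => ‖mulOp (fun _ => (1 / 2 : ℂ) ^ n) (fockKernel (w n)) z‖ := by
  simp_rw [norm_eq_fockWeight_mul_exp, fockWeight_kernelSeries_term]
  exact (summable_kernelSeries_weight w z).mul_right _

lemma differentiable_kernelSeries (w : ℕ → ℂ) : Differentiable ℂ (kernelSeries w) := by
  refine differentiable_tsum_of_forall_summable_bound
    (fun n => (differentiable_const _).mul (differentiable_fockKernel (w n))) fun R =>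
    ⟨fun n => (1 / 2) ^ n * Real.exp (R ^ 2 / 2), summable_geometric_two.mul_right _,
      fun n z hz => ?_⟩
  change ‖mulOp (fun _ => (1 / 2 : ℂ) ^ n) (fockKernel (w n)) z‖ ≤
    (1 / 2) ^ n * Real.exp (R ^ 2 / 2)
  rw [norm_eq_fockWeight_mul_exp]
  have h1 := fockWeight_kernelSeries_term_le (w n) n z
  gcongr

lemma fockWeight_kernelSeries_le (w : ℕ → ℂ) (z : ℂ) :
    fockWeight (kernelSeries w) z ≤ ∑' n, (1 / 2) ^ n * Real.exp (-(‖z - w n‖ ^ 2 / 2)) := by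
  simp_rw [← fockWeight_kernelSeries_term]
  exact fockWeight_tsum_le (summable_norm_kernelSeries_term w z)

/-- For p ≤ 1 the integral of the p-th power is subadditive, leaving a geometric series of ratio
2^{-p}; larger p follow from 𝓕_1 ⊆ 𝓕_p. No separation of the points is needed. -/
lemma kernelSeries_mem_fockSpace {p : ℝ≥0∞} (hp0 : 0 < p) (w : ℕ → ℂ) :
    kernelSeries w ∈ fockSpace p := by
  wlog hp1 : p ≤ 1 generalizing p
  · exact fockSpace_mono one_pos (not_le.1 hp1).le (this one_pos le_rfl)
  have hp : p ≠ ∞ := ne_top_of_le_ne_top ENNReal.one_ne_top hp1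
  set r := p.toReal with hr
  have hpr : 0 < r := ENNReal.toReal_pos hp0.ne' hp
  have hr1 : r ≤ 1 := by simpa using ENNReal.toReal_mono ENNReal.one_ne_top hp1
  refine ⟨differentiable_kernelSeries w, (fockNorm_lt_top_iff hp0 hp _).2 ?_⟩
  rw [← hr]
  set G := ∫⁻ z : ℂ, ENNReal.ofReal (Real.exp (-(‖z‖ ^ 2 / 2)) ^ r) with hG
  calc ∫⁻ z, ENNReal.ofReal (fockWeight (kernelSeries w) z ^ r)
      ≤ ∫⁻ z, ∑' n, (ENNReal.ofReal ((1 / 2) ^ r)) ^ n *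
          ENNReal.ofReal (fockWeight (fockKernel (w n)) z ^ r) := by
        refine lintegral_mono fun z => ?_
        rw [ofReal_fockWeight_rpow _ z hpr.le]
        calc ENNReal.ofReal (fockWeight (kernelSeries w) z) ^ r
            ≤ (∑' n, ENNReal.ofReal ((1 / 2) ^ n * Real.exp (-(‖z - w n‖ ^ 2 / 2)))) ^ r := by
              rw [← ENNReal.ofReal_tsum_of_nonneg (fun n => by positivity)
                (summable_kernelSeries_weight w z)]
              gcongr
              exact fockWeight_kernelSeries_le w z
          _ ≤ _ := ENNReal.tsum_rpow_le _ hpr hr1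
          _ = _ := by
              refine tsum_congr fun n => ?_
              rw [fockWeight_fockKernel, ENNReal.ofReal_mul (by positivity),
                ENNReal.mul_rpow_of_nonneg _ _ hpr.le,
                ENNReal.ofReal_rpow_of_nonneg (by positivity) hpr.le,
                ENNReal.ofReal_rpow_of_nonneg (by positivity) hpr.le,
                ← ENNReal.ofReal_pow (by positivity), Real.rpow_pow_comm (by norm_num)]
    _ = ∑' n, (ENNReal.ofReal ((1 / 2) ^ r)) ^ n * G := by
        rw [lintegral_tsum fun n => ((measurable_fockWeight_rpow
          (differentiable_fockKernel (w n)).continuous r).const_mul _).aemeasurable]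
        refine tsum_congr fun n => ?_
        rw [lintegral_const_mul _ (measurable_fockWeight_rpow
          (differentiable_fockKernel (w n)).continuous r), lintegral_fockWeight_fockKernel_rpow]
    _ < ∞ := by
        rw [ENNReal.tsum_mul_right, ENNReal.tsum_geometric]
        refine ENNReal.mul_lt_top (ENNReal.inv_lt_top.2 (tsub_pos_of_lt ?_))
          (lintegral_gaussian_rpow_lt_top hpr)
        rw [ENNReal.ofReal_lt_one]
        exact Real.rpow_lt_one (by norm_num) (by norm_num) hpr

/-- If the points `wₙ` are well separated, `∑ 2⁻ⁿ k_{wₙ}` is dominated at `wₙ` by its `n`-th term. -/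
lemma fockWeight_kernelSeries_ge {w : ℕ → ℂ}
    (hw : ∀ m n : ℕ, m ≠ n → (m + n + 2 : ℝ) ≤ ‖w n - w m‖) (n : ℕ) :
    (1 / 2) ^ n / 2 ≤ fockWeight (kernelSeries w) (w n) := by
  set T : ℕ → ℂ → ℂ := fun m => mulOp (fun _ => (1 / 2 : ℂ) ^ m) (fockKernel (w m)) with hT
  have hsum : Summable fun m => T m (w n) := (summable_norm_kernelSeries_term w (w n)).of_norm
  have hsplit : kernelSeries w (w n) = T n (w n) + ∑' m, if m = n then 0 else T m (w n) :=
    hsum.tsum_eq_add_tsum_ite n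
  -- Separation t ≥ m+n+2 ≥ 2 gives t²/2 ≥ m+n+2, so the m-th term is at most 4^{-m}/4 times the
  -- main one. These sum to 1/3 of the main term, leaving more than half of it.
  have hbound : ∀ m, ‖if m = n then 0 else T m (w n)‖ ≤
      (1 / 4) ^ m * ((1 / 2) ^ n * (1 / 4) * Real.exp (‖w n‖ ^ 2 / 2)) := fun m => by
    split_ifs with h
    · rw [norm_zero]; positivity
    · rw [norm_eq_fockWeight_mul_exp, hT, fockWeight_kernelSeries_term]
      have ht := hw m n h
      set t := ‖w n - w m‖
      have h1 : Real.exp (-(t ^ 2 / 2)) ≤ (1 / 2) ^ (m + n + 2) := by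
        have h2 : (1 / 2 : ℝ) ^ (m + n + 2) = Real.exp (-((m + n + 2 : ℝ) * Real.log 2)) := by
          rw [← neg_mul, neg_mul_comm, ← Real.log_inv, mul_comm, Real.exp_mul, Real.exp_log (by norm_num)]
          norm_num [← Real.rpow_natCast]
        rw [h2, Real.exp_le_exp, neg_le_neg_iff]
        have h3 : Real.log 2 ≤ 1 := Real.log_two_lt_d9.le.trans (by norm_num)
        have h4 : (0 : ℝ) ≤ m + n := by positivity
        nlinarith
      calc (1 / 2) ^ m * Real.exp (-(t ^ 2 / 2)) * Real.exp (‖w n‖ ^ 2 / 2)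
          ≤ (1 / 2) ^ m * (1 / 2) ^ (m + n + 2) * Real.exp (‖w n‖ ^ 2 / 2) := by gcongr
        _ = _ := by
          have : (1 / 4 : ℝ) ^ m = (1 / 2) ^ m * (1 / 2) ^ m := by rw [← mul_pow]; norm_num
          rw [this]; ring
  have hgeo : HasSum (fun m : ℕ => (1 / 4 : ℝ) ^ m) (4 / 3) := by
    have := hasSum_geometric_of_lt_one (r := (1 / 4 : ℝ)) (by norm_num) (by norm_num)
    norm_num at this ⊢; exact this
  have htail := tsum_of_norm_bounded (hgeo.mul_right _) hbound
  have hmain : ‖T n (w n)‖ = (1 / 2) ^ n * Real.exp (‖w n‖ ^ 2 / 2) := by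
    rw [norm_eq_fockWeight_mul_exp, hT, fockWeight_kernelSeries_term]; simp
  have hnorm : (1 / 2) ^ n / 2 * Real.exp (‖w n‖ ^ 2 / 2) ≤ ‖kernelSeries w (w n)‖ := by
    rw [hsplit]
    have h1 := norm_sub_le_norm_add (T n (w n)) (∑' m, if m = n then 0 else T m (w n))
    have h2 : 0 < (1 / 2 : ℝ) ^ n * Real.exp (‖w n‖ ^ 2 / 2) := by positivity
    linarith
  rw [norm_eq_fockWeight_mul_exp] at hnorm
  exact le_of_mul_le_mul_right hnorm (Real.exp_pos _)

/-! ### Multipliers are constant -/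

/-- Greedy choice of points with increasing modulus. The growth 4ⁿ is there to beat the coefficients
2⁻ⁿ of `kernelSeries`. -/
lemma exists_separated_seq {u : ℂ → ℂ} (hu : ∀ K R : ℝ, ∃ w, R ≤ ‖w‖ ∧ K ≤ ‖u w‖) :
    ∃ w : ℕ → ℂ, (∀ m n : ℕ, m ≠ n → (m + n + 2 : ℝ) ≤ ‖w n - w m‖) ∧ ∀ n, 4 ^ n ≤ ‖u (w n)‖ := by
  choose φ hφR hφK using hu
  -- The increment 2k+3 = k+(k+1)+2 is the separation required of consecutive points.
  set w : ℕ → ℂ := fun n => Nat.rec (φ (4 ^ 0) 0) (fun k v => φ (4 ^ (k + 1)) (‖v‖ + 2 * k + 3)) n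
    with hw
  have hstep : ∀ n, ‖w n‖ + 2 * n + 3 ≤ ‖w (n + 1)‖ := fun n => hφR _ _
  have hlt : ∀ m n : ℕ, m < n → (m + n + 2 : ℝ) ≤ ‖w n‖ - ‖w m‖ := fun m n hmn => by
    induction n, hmn using Nat.le_induction with
    | base => have := hstep m; push_cast; linarith
    | succ n hn ih =>
      have := hstep n
      have h2 : (0 : ℝ) ≤ n := by positivity
      push_cast; linarith
  refine ⟨w, fun m n hmn => ?_, fun n => ?_⟩
  · rcases hmn.lt_or_gt with h | h
    · exact (hlt m n h).trans (norm_sub_norm_le _ _)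
    · rw [norm_sub_rev, add_comm (m : ℝ)]
      exact (hlt n m h).trans (norm_sub_norm_le _ _)
  · cases n <;> exact hφK _ _

/-- Liouville: otherwise u is bounded off a disc, and on the disc by compactness. -/
lemma forall_exists_le_norm_of_not_const {u : ℂ → ℂ} (hu : Differentiable ℂ u)
    (hc : ¬ ∃ c : ℂ, ∀ z, u z = c) (K R : ℝ) : ∃ w, R ≤ ‖w‖ ∧ K ≤ ‖u w‖ := by
  by_contra! h
  obtain ⟨M, hM⟩ := (isCompact_closedBall (0 : ℂ) R).exists_bound_of_continuousOn
    hu.continuous.continuousOn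
  have hb : Bornology.IsBounded (Set.range u) := by
    refine isBounded_iff_forall_norm_le.2 ⟨max M K, ?_⟩
    rintro _ ⟨z, rfl⟩
    rcases le_total ‖z‖ R with hz | hz
    · exact (hM z (by simpa using hz)).trans (le_max_left _ _)
    · exact (h z hz).le.trans (le_max_right _ _)
  obtain ⟨c, hc'⟩ := hu.exists_eq_const_of_bounded hb
  exact hc ⟨c, fun z => by rw [hc']; rfl⟩

/-- A multiplier between Fock spaces is constant. -/
lemma MulOpMaps.exists_eq_const {p q : ℝ≥0∞} {u : ℂ → ℂ} (h : MulOpMaps p q u) (hp : 0 < p)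
    (hq : 0 < q) (hu : Differentiable ℂ u) : ∃ c : ℂ, ∀ z, u z = c := by
  by_contra hc
  obtain ⟨w, hw, huw⟩ := exists_separated_seq (forall_exists_le_norm_of_not_const hu hc)
  have hmem := h (kernelSeries_mem_fockSpace hp w)
  obtain ⟨C, hC⟩ := exists_ofReal_fockWeight_le_fockNorm hq
  set N := C * fockNorm q (mulOp u (kernelSeries w)) with hN
  have hNtop : N ≠ ∞ := (ENNReal.mul_lt_top ENNReal.coe_lt_top hmem.2).ne
  obtain ⟨n, hn⟩ := pow_unbounded_of_one_lt (2 * N.toReal) (one_lt_two (α := ℝ))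
  have h1 := hC _ hmem.1 (w n)
  rw [← hN, ENNReal.ofReal_le_iff_le_toReal hNtop, fockWeight_mul] at h1
  have h2 : (4 : ℝ) ^ n * ((1 / 2) ^ n / 2) ≤ N.toReal :=
    le_trans (mul_le_mul (huw n) (fockWeight_kernelSeries_ge hw n) (by positivity)
      (norm_nonneg _)) h1
  have h3 : (4 : ℝ) ^ n * ((1 / 2) ^ n / 2) = 2 ^ n / 2 := by
    rw [mul_div_assoc', ← mul_pow]; norm_num
  linarith

/-! ### Kernels on the integer lattice: 𝓕_p is not contained in 𝓕_q for q < p -/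

lemma summable_int_exp_neg_sq : Summable fun k : ℤ => Real.exp (-((k : ℝ) ^ 2 / 16)) := by
  have h : Summable fun n : ℕ => Real.exp (-((n : ℝ) ^ 2 / 16)) := by
    have := Real.summable_exp_nat_mul_of_ge (c := -1 / 16) (by norm_num)
      (f := fun n : ℕ => (n : ℝ) ^ 2) (fun n => by exact_mod_cast Nat.le_self_pow two_ne_zero n)
    refine this.congr fun n => ?_
    congr 1; ring
  refine Summable.of_nat_of_neg (by simpa using h) (by simpa using h)

/-- Re-centring at the nearest integer costs a factor 2 in distance, since |x - round x| ≤ 1/2; this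
makes the Gaussian sums bounded uniformly in x. -/
lemma exp_neg_sq_sub_int_le (x : ℝ) (n : ℤ) :
    Real.exp (-((x - n) ^ 2 / 4)) ≤ Real.exp (-(((n - round x : ℤ) : ℝ) ^ 2 / 16)) := by
  rw [Real.exp_le_exp, neg_le_neg_iff]
  have h1 : |x - round x| ≤ 1 / 2 := abs_sub_round x
  have h2 : |((n - round x : ℤ) : ℝ)| ≤ 2 * |x - n| := by
    rcases eq_or_ne n (round x) with h | h
    · simp [h]
    · have h3 : (1 : ℝ) ≤ |((n - round x : ℤ) : ℝ)| := by
        exact_mod_cast Int.one_le_abs (sub_ne_zero.2 h)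
      have h4 : |((n - round x : ℤ) : ℝ)| ≤ |x - n| + |x - round x| := by
        have : ((n - round x : ℤ) : ℝ) = (x - round x) - (x - n) := by push_cast; ring
        rw [this, add_comm]; exact abs_sub _ _
      linarith
  have h5 := mul_self_le_mul_self (abs_nonneg _) h2
  rw [abs_mul_abs_self] at h5
  have h6 := abs_mul_abs_self (x - (n : ℝ))
  nlinarith

/-- The sum of `e^{-k²/16}` over the integers. -/
noncomputable def intGaussSum : ℝ := ∑' k : ℤ, Real.exp (-((k : ℝ) ^ 2 / 16))

lemma summable_exp_neg_sq_sub_int (x : ℝ) :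
    Summable fun n : ℤ => Real.exp (-((x - n) ^ 2 / 4)) :=
  ((Equiv.subRight (round x)).summable_iff.2 summable_int_exp_neg_sq).of_nonneg_of_le
    (fun _ => (Real.exp_pos _).le) (exp_neg_sq_sub_int_le x)

lemma tsum_exp_neg_sq_sub_int_le (x : ℝ) :
    ∑' n : ℤ, Real.exp (-((x - n) ^ 2 / 4)) ≤ intGaussSum := by
  rw [intGaussSum, ← (Equiv.subRight (round x)).tsum_eq fun k : ℤ => Real.exp (-((k : ℝ) ^ 2 / 16))]
  exact (summable_exp_neg_sq_sub_int x).tsum_le_tsum (exp_neg_sq_sub_int_le x)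
    ((Equiv.subRight (round x)).summable_iff.2 summable_int_exp_neg_sq)

/-- A polynomially decaying weight at `n` is comparable to that at `x`, up to a Gaussian loss. -/
lemma one_add_abs_rpow_mul_exp_le {s : ℝ} (hs : 0 ≤ s) (x y : ℝ) :
    (1 + |y|) ^ (-s) * Real.exp (-((x - y) ^ 2 / 2)) ≤
      Real.exp (s ^ 2) * (1 + |x|) ^ (-s) * Real.exp (-((x - y) ^ 2 / 4)) := by
  have hx : 0 < 1 + |x| := by positivity
  have hy : 0 < 1 + |y| := by positivity
  have h1 : 1 + |x| ≤ (1 + |y|) * Real.exp |x - y| := by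
    have h2 : 1 + |x - y| ≤ Real.exp |x - y| := by
      have := Real.add_one_le_exp |x - y|; linarith
    have h3 : |x| ≤ |x - y| + |y| := by simpa using abs_add_le (x - y) y
    calc 1 + |x| ≤ (1 + |y|) * (1 + |x - y|) := by
          nlinarith [mul_nonneg (abs_nonneg y) (abs_nonneg (x - y))]
      _ ≤ _ := by gcongr
  have h4 : (1 + |y|) ^ (-s) ≤ (1 + |x|) ^ (-s) * Real.exp (s * |x - y|) := by
    rw [Real.rpow_neg hx.le, Real.rpow_neg hy.le, ← div_eq_inv_mul, le_div_iff₀ (by positivity),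
      ← div_eq_inv_mul, div_le_iff₀ (by positivity)]
    calc (1 + |x|) ^ s ≤ ((1 + |y|) * Real.exp |x - y|) ^ s := by gcongr
      _ = _ := by rw [Real.mul_rpow hy.le (Real.exp_pos _).le, ← Real.exp_mul, mul_comm, mul_comm s]
  calc (1 + |y|) ^ (-s) * Real.exp (-((x - y) ^ 2 / 2))
      ≤ (1 + |x|) ^ (-s) * Real.exp (s * |x - y|) * Real.exp (-((x - y) ^ 2 / 2)) := by gcongr
    _ = (1 + |x|) ^ (-s) * Real.exp (s * |x - y| + -((x - y) ^ 2 / 2)) := by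
        rw [mul_assoc, ← Real.exp_add]
    -- With t = |x-y|, (s - t/2)² ≥ 0 gives st ≤ s² + t²/4: half of the Gaussian pays for the change
    -- of weight.
    _ ≤ (1 + |x|) ^ (-s) * Real.exp (s ^ 2 + -((x - y) ^ 2 / 4)) := by
        refine mul_le_mul_of_nonneg_left (Real.exp_le_exp.2 ?_) (by positivity)
        have h5 := sq_abs (x - y)
        nlinarith [sq_nonneg (s - |x - y| / 2)]
    _ = _ := by rw [Real.exp_add]; ring

/-- The superposition `∑ (1 + |n|)^{-s} k_n` of the normalized kernels at the integers. -/
noncomputable def latticeSeries (s : ℝ) (z : ℂ) : ℂ :=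
  ∑' n : ℤ, mulOp (fun _ => (((1 + |(n : ℝ)|) ^ (-s) : ℝ) : ℂ)) (fockKernel n) z

lemma fockWeight_latticeSeries_term (s : ℝ) (n : ℤ) (z : ℂ) :
    fockWeight (mulOp (fun _ => (((1 + |(n : ℝ)|) ^ (-s) : ℝ) : ℂ)) (fockKernel n)) z =
      (1 + |(n : ℝ)|) ^ (-s) * Real.exp (-((z.re - n) ^ 2 / 2)) * Real.exp (-(z.im ^ 2 / 2)) := by
  rw [fockWeight_mul, fockWeight_fockKernel, Complex.norm_real, Real.norm_of_nonneg (by positivity),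
    mul_assoc, ← Real.exp_add, ← Complex.normSq_eq_norm_sq, Complex.normSq_apply]
  congr 2
  simp
  ring

lemma fockWeight_latticeSeries_term_le {s : ℝ} (hs : 0 ≤ s) (n : ℤ) (z : ℂ) :
    fockWeight (mulOp (fun _ => (((1 + |(n : ℝ)|) ^ (-s) : ℝ) : ℂ)) (fockKernel n)) z ≤
      Real.exp (-((z.re - n) ^ 2 / 4)) *
        (Real.exp (s ^ 2) * (1 + |z.re|) ^ (-s) * Real.exp (-(z.im ^ 2 / 2))) := by
  rw [fockWeight_latticeSeries_term]
  have := mul_le_mul_of_nonneg_right (one_add_abs_rpow_mul_exp_le hs z.re n)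
    (Real.exp_pos (-(z.im ^ 2 / 2))).le
  linarith

lemma summable_fockWeight_latticeSeries_term {s : ℝ} (hs : 0 ≤ s) (z : ℂ) :
    Summable fun n : ℤ =>
      fockWeight (mulOp (fun _ => (((1 + |(n : ℝ)|) ^ (-s) : ℝ) : ℂ)) (fockKernel n)) z :=
  ((summable_exp_neg_sq_sub_int z.re).mul_right _).of_nonneg_of_le
    (fun _ => fockWeight_nonneg _ _) fun n => fockWeight_latticeSeries_term_le hs n z

lemma summable_norm_latticeSeries_term {s : ℝ} (hs : 0 ≤ s) (z : ℂ) :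
    Summable fun n : ℤ =>
      ‖mulOp (fun _ => (((1 + |(n : ℝ)|) ^ (-s) : ℝ) : ℂ)) (fockKernel n) z‖ := by
  simp_rw [norm_eq_fockWeight_mul_exp _ z]
  exact (summable_fockWeight_latticeSeries_term hs z).mul_right _

lemma fockWeight_latticeSeries_le {s : ℝ} (hs : 0 ≤ s) (z : ℂ) :
    fockWeight (latticeSeries s) z ≤
      intGaussSum * (Real.exp (s ^ 2) * (1 + |z.re|) ^ (-s) * Real.exp (-(z.im ^ 2 / 2))) := by
  refine (fockWeight_tsum_le (summable_norm_latticeSeries_term hs z)).trans ?_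
  refine ((summable_fockWeight_latticeSeries_term hs z).tsum_le_tsum
    (fun n => fockWeight_latticeSeries_term_le hs n z)
    ((summable_exp_neg_sq_sub_int z.re).mul_right _)).trans ?_
  rw [tsum_mul_right]
  gcongr
  exact tsum_exp_neg_sq_sub_int_le z.re

lemma norm_fockKernel_intCast (n : ℤ) (z : ℂ) :
    ‖fockKernel n z‖ = Real.exp (n * z.re - (n : ℝ) ^ 2 / 2) := by
  rw [fockKernel, Complex.norm_exp]
  congr 1
  have h1 : ((‖(n : ℂ)‖ : ℂ) ^ 2 / 2).re = (n : ℝ) ^ 2 / 2 := by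
    rw [Complex.norm_intCast]; norm_cast; simp
  rw [Complex.sub_re, h1]
  simp

lemma differentiable_latticeSeries {s : ℝ} (hs : 0 ≤ s) : Differentiable ℂ (latticeSeries s) := by
  refine differentiable_tsum_of_forall_summable_bound
    (fun n => (differentiable_const _).mul (differentiable_fockKernel n)) fun R =>
    ⟨fun n => Real.exp (R ^ 2) * Real.exp (-((n : ℝ) ^ 2 / 16)),
      summable_int_exp_neg_sq.mul_left _, fun n z hz => ?_⟩
  beta_reduce
  rw [mulOp, norm_mul, Complex.norm_real, Real.norm_of_nonneg (by positivity),
    norm_fockKernel_intCast,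
    ← Real.exp_add]
  refine (mul_le_of_le_one_left (Real.exp_pos _).le ?_).trans (Real.exp_le_exp.2 ?_)
  · exact Real.rpow_le_one_of_one_le_of_nonpos (by simp) (by simpa using hs)
  · have h1 : z.re ^ 2 ≤ R ^ 2 := by
      have := Complex.abs_re_le_norm z
      exact sq_le_sq' (by linarith [neg_abs_le z.re]) (by linarith [le_abs_self z.re])
    nlinarith [sq_nonneg (z.re - n / 2), sq_nonneg (n : ℝ)]

lemma integrable_rpow_one_add_abs_re_mul_gaussian_im {a b : ℝ} (ha : 1 < a) (hb : 0 < b) :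
    Integrable fun z : ℂ => (1 + |z.re|) ^ (-a) * Real.exp (-b * z.im ^ 2) := by
  have h1 : Integrable fun x : ℝ => (1 + ‖x‖) ^ (-a) := integrable_one_add_norm (by simpa using ha)
  have h2 := h1.mul_prod (integrable_exp_neg_mul_sq hb)
  exact (Complex.volume_preserving_equiv_real_prod.integrable_comp_emb
    Complex.measurableEquivRealProd.measurableEmbedding).2 h2

/-- The weighted modulus is dominated by (1+|Re z|)^{-s} times a Gaussian in Im z, whose p-th power
is integrable once ps > 1. -/
lemma latticeSeries_mem_fockSpace {p : ℝ≥0∞} {s : ℝ} (hs : 0 < s)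
    (hps : p ≠ ∞ → 1 < p.toReal * s) : latticeSeries s ∈ fockSpace p := by
  refine ⟨differentiable_latticeSeries hs.le, ?_⟩
  have hS : 0 ≤ intGaussSum := tsum_nonneg fun _ => (Real.exp_pos _).le
  by_cases hp : p = ∞
  · subst hp
    rw [fockNorm_top]
    refine lt_of_le_of_lt (iSup_le fun z => ENNReal.ofReal_le_ofReal
      (q := intGaussSum * (Real.exp (s ^ 2) * 1 * 1)) ?_) ENNReal.ofReal_lt_top
    refine (fockWeight_latticeSeries_le hs.le z).trans ?_
    gcongr
    · exact Real.rpow_le_one_of_one_le_of_nonpos (by simp) (by simpa using hs.le)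
    · exact exp_neg_sq_half_le_one _
  have hps' := hps hp
  have hpr : 0 < p.toReal := by
    by_contra! h
    nlinarith
  rw [fockNorm_lt_top_iff (ENNReal.toReal_pos_iff.1 hpr).1 hp]
  have hint := (integrable_rpow_one_add_abs_re_mul_gaussian_im hps' (half_pos hpr)).const_mul
    ((intGaussSum * Real.exp (s ^ 2)) ^ p.toReal)
  refine lt_of_le_of_lt (lintegral_mono fun z => ENNReal.ofReal_le_ofReal ?_) hint.lintegral_lt_top
  refine (Real.rpow_le_rpow (fockWeight_nonneg _ _) (fockWeight_latticeSeries_le hs.le z)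
    hpr.le).trans_eq ?_
  have h1 : 0 ≤ 1 + |z.re| := by positivity
  rw [mul_assoc (Real.exp _), ← mul_assoc, Real.mul_rpow (by positivity) (by positivity),
    Real.mul_rpow (x := (1 + |z.re|) ^ (-s)) (by positivity) (by positivity), ← Real.rpow_mul h1,
    ← Real.exp_mul]
  congr 3
  · ring
  · ring_nf

/-- At an integer every term is a positive real, so nothing cancels and the n-th term alone is a
lower bound. -/
lemma fockWeight_latticeSeries_ge {s : ℝ} (hs : 0 ≤ s) (n : ℤ) :
    (1 + |(n : ℝ)|) ^ (-s) ≤ fockWeight (latticeSeries s) n := by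
  have hker : ∀ m : ℤ, mulOp (fun _ => (((1 + |(m : ℝ)|) ^ (-s) : ℝ) : ℂ)) (fockKernel m) n =
      (((1 + |(m : ℝ)|) ^ (-s) * Real.exp (m * n - (m : ℝ) ^ 2 / 2) : ℝ) : ℂ) := fun m => by
    rw [mulOp, fockKernel, Complex.norm_intCast, Complex.ofReal_mul, Complex.ofReal_exp]
    congr 2
    rw [← Complex.ofReal_pow, sq_abs]
    push_cast
    simp
  have hsum := summable_norm_latticeSeries_term hs (n : ℂ)
  have hnn : ∀ m : ℤ, 0 ≤ (1 + |(m : ℝ)|) ^ (-s) * Real.exp (m * n - (m : ℝ) ^ 2 / 2) :=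
    fun m => by positivity
  simp_rw [hker, Complex.norm_real, fun m => Real.norm_of_nonneg (hnn m)] at hsum
  have hle := hsum.le_tsum n fun m _ => hnn m
  have heq : ‖latticeSeries s n‖ =
      ∑' m : ℤ, (1 + |(m : ℝ)|) ^ (-s) * Real.exp (m * n - (m : ℝ) ^ 2 / 2) := by
    rw [latticeSeries]
    simp_rw [hker]
    rw [← Complex.ofReal_tsum, Complex.norm_real,
      Real.norm_of_nonneg (tsum_nonneg hnn)]
  rw [fockWeight, heq, Complex.norm_intCast, sq_abs]
  refine le_trans (le_of_eq ?_) (mul_le_mul_of_nonneg_right hle (Real.exp_pos _).le)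
  rw [mul_assoc, ← Real.exp_add]
  ring_nf
  simp

lemma pairwise_disjoint_ball_natCast :
    Pairwise (Function.onFun Disjoint fun n : ℕ => ball (n : ℂ) (1 / 2)) := by
  intro m n hmn
  refine ball_disjoint_ball ?_
  rw [Complex.dist_eq]
  have h0 : (m : ℤ) - n ≠ 0 := sub_ne_zero.2 (Nat.cast_injective.ne hmn)
  have h : (1 : ℝ) ≤ |(((m : ℤ) - n : ℤ) : ℝ)| := by
    rw [← Int.cast_abs]
    exact_mod_cast Int.one_le_abs h0
  rw [show (m : ℂ) - n = (((m : ℤ) - n : ℤ) : ℂ) by push_cast; rfl, Complex.norm_intCast]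
  linarith

/-- The q-th power of the weighted modulus at n ∈ ℕ is at least 1/(n+1). The local estimate on the
disjoint balls of radius 1/2 would bound the harmonic series by the integral. -/
lemma latticeSeries_notMem_fockSpace {q : ℝ≥0∞} (hq0 : 0 < q) (hq : q ≠ ∞) :
    latticeSeries (1 / q.toReal) ∉ fockSpace q := by
  intro hmem
  have hqr : 0 < q.toReal := ENNReal.toReal_pos hq0.ne' hq
  set s := 1 / q.toReal with hs
  have hs0 : 0 ≤ s := by positivity
  obtain ⟨C, hC⟩ := exists_rpow_fockWeight_le_setLIntegral hqr
  have hI := (fockNorm_lt_top_iff hq0 hq _).1 hmem.2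
  have hsum : ∑' n : ℕ, ENNReal.ofReal (1 / ((n : ℝ) + 1)) < ∞ := by
    calc ∑' n : ℕ, ENNReal.ofReal (1 / ((n : ℝ) + 1))
        ≤ ∑' n : ℕ, C * ∫⁻ z in ball (n : ℂ) (1 / 2),
            ENNReal.ofReal (fockWeight (latticeSeries s) z ^ q.toReal) := by
          refine ENNReal.tsum_le_tsum fun n => le_trans (ENNReal.ofReal_le_ofReal ?_)
            (hC _ hmem.1 n)
          have h1 := fockWeight_latticeSeries_ge hs0 n
          rw [Int.cast_natCast, Int.cast_natCast, Nat.abs_cast] at h1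
          refine le_trans (le_of_eq ?_) (Real.rpow_le_rpow (by positivity) h1 hqr.le)
          rw [← Real.rpow_mul (by positivity), hs, neg_mul, one_div_mul_cancel hqr.ne',
            Real.rpow_neg_one, one_div, add_comm]
      _ = C * ∫⁻ z in ⋃ n : ℕ, ball (n : ℂ) (1 / 2),
            ENNReal.ofReal (fockWeight (latticeSeries s) z ^ q.toReal) := by
          rw [ENNReal.tsum_mul_left, lintegral_iUnion (fun _ => measurableSet_ball)
            pairwise_disjoint_ball_natCast]
      _ ≤ C * ∫⁻ z, ENNReal.ofReal (fockWeight (latticeSeries s) z ^ q.toReal) :=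
          mul_le_mul' le_rfl (setLIntegral_le_lintegral _ _)
      _ < ∞ := ENNReal.mul_lt_top ENNReal.coe_lt_top hI
  have := ENNReal.summable_toReal hsum.ne
  refine Real.not_summable_one_div_natCast ((summable_nat_add_iff 1).1 (this.congr fun n => ?_))
  rw [ENNReal.toReal_ofReal (by positivity)]
  push_cast; rfl

lemma fockNorm_lt_top_of_mulOp_const {q : ℝ≥0∞} (hq : 0 < q) {c : ℂ} (hc : c ≠ 0) {f : ℂ → ℂ}
    (h : fockNorm q (mulOp (fun _ => c) f) < ∞) : fockNorm q f < ∞ := by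
  rw [fockNorm_mulOp_const hq] at h
  exact ENNReal.lt_top_of_mul_ne_top_right h.ne (by simpa using hc)

lemma not_mulOpMaps_const_of_lt {p q : ℝ≥0∞} (hq : 0 < q) (hqp : q < p) {c : ℂ} (hc : c ≠ 0) :
    ¬ MulOpMaps p q fun _ => c := by
  intro h
  have hqt : q ≠ ∞ := hqp.ne_top
  have hqr : 0 < q.toReal := ENNReal.toReal_pos hq.ne' hqt
  have hmem : latticeSeries (1 / q.toReal) ∈ fockSpace p :=
    latticeSeries_mem_fockSpace (by positivity) fun hp => by
      rw [mul_one_div, one_lt_div hqr]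
      exact ENNReal.toReal_strict_mono hp hqp
  exact latticeSeries_notMem_fockSpace hq hqt
    ⟨hmem.1, fockNorm_lt_top_of_mulOp_const hq hc (h hmem).2⟩

/-! ### Constant multipliers: boundedness and failure of compactness -/

lemma mulOp_sub (u f g : ℂ → ℂ) : mulOp u f - mulOp u g = mulOp u (f - g) := by
  funext z; simp [mulOp, mul_sub]

lemma exists_fockNorm_mulOp_const_le {p q : ℝ≥0∞} (hp : 0 < p) (hpq : p ≤ q) (c : ℂ) :
    ∃ C : ℝ≥0, ∀ f : ℂ → ℂ, Differentiable ℂ f →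
      fockNorm q (mulOp (fun _ => c) f) ≤ C * fockNorm p f := by
  obtain ⟨C, hC⟩ := exists_fockNorm_le_fockNorm hp hpq
  refine ⟨‖c‖₊ * C, fun f hf => ?_⟩
  rw [fockNorm_mulOp_const (hp.trans_le hpq), ENNReal.coe_mul, mul_assoc]
  exact mul_le_mul' le_rfl (hC f hf)

lemma mulOpBounded_const {p q : ℝ≥0∞} (hp : 0 < p) (hpq : p ≤ q) (c : ℂ) :
    MulOpBounded p q fun _ => c := by
  obtain ⟨C, hC⟩ := exists_fockNorm_mulOp_const_le hp hpq c
  exact ⟨fun f hf => ⟨(differentiable_const c).mul hf.1,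
    (hC f hf.1).trans_lt (ENNReal.mul_lt_top ENNReal.coe_lt_top hf.2)⟩, C, fun f hf => hC f hf.1⟩

lemma mulOpLipschitz_const {p q : ℝ≥0∞} (hp : 0 < p) (hpq : p ≤ q) (c : ℂ) :
    MulOpLipschitz p q fun _ => c := by
  obtain ⟨C, hC⟩ := exists_fockNorm_mulOp_const_le hp hpq c
  refine ⟨(mulOpBounded_const hp hpq c).1, C, fun f hf g hg => ?_⟩
  rw [mulOp_sub]
  exact hC _ (hf.1.sub hg.1)

/-- Normalized kernels at points tending to infinity have no subsequence converging in norm. -/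
lemma not_mulOpCompact_const {p q : ℝ≥0∞} (hp : 0 < p) (hq : 0 < q) {c : ℂ} (hc : c ≠ 0) :
    ¬ MulOpCompact p q fun _ => c := by
  rintro ⟨-, h⟩
  obtain ⟨R, hR⟩ := exists_fockNorm_fockKernel_le hp
  obtain ⟨g, hg, φ, hφ, hlim⟩ := h (fun n : ℕ => fockKernel n)
    (fun n => ⟨differentiable_fockKernel _, (hR _).trans_lt ENNReal.coe_lt_top⟩) ⟨R, fun n => hR n⟩
  obtain ⟨C, hC⟩ := exists_ofReal_fockWeight_le_fockNorm hq
  set D : ℕ → ℂ → ℂ := fun n => mulOp (fun _ => c) (fockKernel (φ n : ℂ)) - g with hD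
  have hDd : ∀ n, Differentiable ℂ (D n) := fun n =>
    ((differentiable_const c).mul (differentiable_fockKernel _)).sub hg.1
  have hunif : Filter.Tendsto (fun n => C * fockNorm q (D n)) Filter.atTop (nhds 0) := by
    simpa using ENNReal.Tendsto.const_mul hlim (Or.inr (ENNReal.coe_ne_top (r := C)))
  -- The pointwise bound is uniform, so the evaluation point may move with n. A fixed point forces g
  -- = 0; the moving peak φ n then gives |c| = 0.
  have hweight : ∀ z : ℕ → ℂ,
      Filter.Tendsto (fun n => fockWeight (D n) (z n)) Filter.atTop (nhds 0) := fun z => by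
    have h1 : Filter.Tendsto (fun n => ENNReal.ofReal (fockWeight (D n) (z n))) Filter.atTop
        (nhds 0) := tendsto_of_tendsto_of_tendsto_of_le_of_le tendsto_const_nhds hunif
      (fun _ => zero_le) fun n => hC _ (hDd n) (z n)
    have h2 := (ENNReal.tendsto_toReal ENNReal.zero_ne_top).comp h1
    refine h2.congr fun n => ?_
    exact ENNReal.toReal_ofReal (fockWeight_nonneg _ _)
  have hφt : Filter.Tendsto (fun n => (φ n : ℝ)) Filter.atTop Filter.atTop :=
    tendsto_natCast_atTop_atTop.comp hφ.tendsto_atTop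
  have hker : ∀ z, Filter.Tendsto (fun n => fockKernel (φ n : ℂ) z) Filter.atTop (nhds 0) :=
      fun z => by
    rw [tendsto_zero_iff_norm_tendsto_zero]
    have h1 : ∀ n, ‖fockKernel (φ n : ℂ) z‖ = Real.exp (-((φ n : ℝ) * ((φ n : ℝ) / 2 - z.re))) :=
      fun n => by
        have := norm_fockKernel_intCast (φ n) z
        rw [Int.cast_natCast, Int.cast_natCast] at this
        rw [this]; congr 1; ring
    simp_rw [h1]
    refine Real.tendsto_exp_neg_atTop_nhds_zero.comp (hφt.atTop_mul_atTop₀ ?_)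
    exact Filter.tendsto_atTop_add_const_right _ (-z.re) (hφt.atTop_div_const two_pos)
  have hg0 : ∀ z, g z = 0 := fun z => by
    have h1 : Filter.Tendsto (fun n => fockWeight (D n) z) Filter.atTop
        (nhds (‖c * 0 - g z‖ * Real.exp (-(‖z‖ ^ 2 / 2)))) :=
      ((((hker z).const_mul c).sub_const (g z)).norm).mul_const _
    have h2 := tendsto_nhds_unique h1 (hweight fun _ => z)
    simpa using h2
  have hone : ∀ n, fockWeight (D n) (φ n : ℂ) = ‖c‖ := fun n => by
    have : D n = mulOp (fun _ => c) (fockKernel (φ n : ℂ)) := by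
      funext z; simp [hD, hg0 z]
    rw [this, fockWeight_mul, fockWeight_fockKernel]
    simp
  have h3 := hweight fun n => (φ n : ℂ)
  simp_rw [hone] at h3
  exact hc (norm_eq_zero.1 (tendsto_nhds_unique tendsto_const_nhds h3))

theorem corollary1p3 (p q : ℝ≥0∞) (hp : 0 < p) (hq : 0 < q)
    (u : ℂ → ℂ) (hu : Differentiable ℂ u) (hu0 : u ≠ 0) :
    (p ≤ q → List.TFAE
      [MulOpMaps p q u,
       (∃ c : ℂ, ∀ z, u z = c),
       MulOpBounded p q u,
       MulOpLipschitz p q u]) ∧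
    (q < p → ¬ MulOpMaps p q u) ∧
    ¬ MulOpCompact p q u := by
  -- Mapping 𝓕_p into 𝓕_q already forces constancy, so the two negative statements reduce to nonzero
  -- constants.
  have hconst : MulOpMaps p q u → ∃ c : ℂ, c ≠ 0 ∧ u = fun _ => c := fun h => by
    obtain ⟨c, hc⟩ := h.exists_eq_const hp hq hu
    refine ⟨c, ?_, funext hc⟩
    rintro rfl
    exact hu0 (funext hc)
  refine ⟨fun hpq => ?_, fun hqp h => ?_, fun h => ?_⟩
  · tfae_have 1 → 2 := fun h => h.exists_eq_const hp hq hu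
    tfae_have 2 → 3 := by
      rintro ⟨c, hc⟩
      obtain rfl : u = fun _ => c := funext hc
      exact mulOpBounded_const hp hpq c
    tfae_have 2 → 4 := by
      rintro ⟨c, hc⟩
      obtain rfl : u = fun _ => c := funext hc
      exact mulOpLipschitz_const hp hpq c
    tfae_have 3 → 1 := And.left
    tfae_have 4 → 1 := And.left
    tfae_finish
  · obtain ⟨c, hc, rfl⟩ := hconst h
    exact not_mulOpMaps_const_of_lt hq hqp hc h
  · obtain ⟨c, hc, rfl⟩ := hconst h.1
    exact not_mulOpCompact_const hp hq hc h
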